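/- Let $n\ge 1$, let $U\subseteq\mathbb{R}^{n+1}$ be open with coordinates $(x^0,x^1,\dots,x^n)$, and let $g=(g_{ij})$ be a smooth Lorentzian metric on $U$ (signature $(-,+,\dots,+)$) in null coordinate form, i.e. $$g_{00}=0,\qquad g_{01}=g_{10}=1,\qquad g_{0i}=g_{i0}=0\quad (2\le i\le n),$$ the remaining components $g_{ij}$ $(1\le i,j\le n)$ being otherwise arbitrary smooth functions. On $\tilde U=\{x\in\mathbb{R}^{n+1} : (x^0,0,\dots,0)\in U\}$ let $$h_{PW}=2\,dx^0\,dx^1+\sum_{i,j=2}^n g_{ij}(x^0,0,\dots,0)\,dx^i\,dx^j$$ be the Penrose plane wave limit of $g$, i.e. the componentwise limit as $\varepsilon\to0^+$ of $\varepsilon^{-2}(\varphi_\varepsilon^{-1})^*g$, where $\varphi_\varepsilon(x)=(x^0,x^1/\varepsilon^2,x^2/\varepsilon,\dots,x^n/\varepsilon)$. Then $h_{PW}$ is a smooth Lorentzian metric on $\tilde U$, and: 1. If $g$ is Einstein on $U$, $\mathrm{Ric}=\lambda g$ for some constant $\lambda\in\mathbb{R}$, then $h_{PW}$ is Ricci-flat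 on $\tilde U$. 2. If $g$ is locally conformally flat on $U$ (each point has an open neighborhood on which $e^{2f}g$ has vanishing curvature tensor for some smooth function $f$), then so is $h_{PW}$ on $\tilde U$. 3. If $g$ is locally symmetric on $U$, $\nabla\mathrm{Rm}=0$, then so is $h_{PW}$ on $\tilde U$. 4. If $g$ has parallel Ricci tensor on $U$, $\nabla\mathrm{Ric}=0$, then so does $h_{PW}$ on $\tilde U$. -/

import Mathlib

open scoped ContDiff

/-! ## Metrics in a coordinate chart

A metric in local coordinates `(x⁰, …, xⁿ)` is the matrix-valued function `x ↦ (g_{ij}(x))`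
of its components.  Indices run over `Fin (n + 1)`. -/

noncomputable section

namespace NullLimit

variable {n : ℕ}

/-- Points of the coordinate space `ℝⁿ⁺¹`. -/
abbrev Coord (n : ℕ) : Type := Fin (n + 1) → ℝ

/-- The component matrix `(g_{ij})` of a field of bilinear forms on coordinate space. -/
abbrev MetricField (n : ℕ) : Type := Coord n → Matrix (Fin (n + 1)) (Fin (n + 1)) ℝ

/-- The coordinate partial derivative `∂ᵢ f`. -/
def pd (i : Fin (n + 1)) (f : Coord n → ℝ) (x : Coord n) : ℝ :=
  fderiv ℝ f x (Pi.single i 1)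

/-- The Minkowski matrix `diag(-1, 1, …, 1)`. -/
def minkowski (n : ℕ) : Matrix (Fin (n + 1)) (Fin (n + 1)) ℝ :=
  Matrix.diagonal fun i => if i = 0 then -1 else 1

/-- A Lorentzian scalar product: in some basis its matrix is `diag(-1, 1, …, 1)`.
(Symmetry of `A` follows.) -/
def IsLorentzianMatrix (A : Matrix (Fin (n + 1)) (Fin (n + 1)) ℝ) : Prop :=
  ∃ P : Matrix (Fin (n + 1)) (Fin (n + 1)) ℝ, IsUnit P.det ∧ P.transpose * A * P = minkowski n

/-- `g` is a smooth Lorentzian metric on `U`. -/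
structure IsLorentzianMetricOn (g : MetricField n) (U : Set (Coord n)) : Prop where
  smooth : ∀ i j, ContDiffOn ℝ ∞ (fun x => g x i j) U
  lorentzian : ∀ x ∈ U, IsLorentzianMatrix (g x)

/-! ### Levi-Civita connection and curvature -/

/-- `christoffel g k i j` is `Γᵏᵢⱼ = ½ gᵏˡ (∂ᵢ gⱼₗ + ∂ⱼ gᵢₗ - ∂ₗ gᵢⱼ)`. -/
def christoffel (g : MetricField n) (k i j : Fin (n + 1)) (x : Coord n) : ℝ :=
  (1 / 2) * ∑ l, (g x)⁻¹ k l *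
    (pd i (fun y => g y j l) x + pd j (fun y => g y i l) x - pd l (fun y => g y i j) x)

/-- The curvature endomorphism, `R(∂ᵢ, ∂ⱼ)∂ₖ = ∑ₗ (curvEndo g i j k l) ∂ₗ`, where
`R(X, Y)Z = ∇_X ∇_Y Z - ∇_Y ∇_X Z - ∇_[X,Y] Z`. -/
def curvEndo (g : MetricField n) (i j k l : Fin (n + 1)) (x : Coord n) : ℝ :=
  pd i (christoffel g l j k) x - pd j (christoffel g l i k) x
    + ∑ m, (christoffel g m j k x * christoffel g l i m x
        - christoffel g m i k x * christoffel g l j m x)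

/-- The curvature 4-tensor `Rmᵢⱼₖₗ = g(R(∂ᵢ, ∂ⱼ)∂ₖ, ∂ₗ)`. -/
def riem (g : MetricField n) (i j k l : Fin (n + 1)) (x : Coord n) : ℝ :=
  ∑ m, g x l m * curvEndo g i j k m x

/-- The Ricci tensor, `Ric(Y, Z) = tr (X ↦ R(X, Y)Z)`. -/
def ricci (g : MetricField n) (j k : Fin (n + 1)) (x : Coord n) : ℝ :=
  ∑ i, curvEndo g i j k i x

/-- The components `(∇ₚ Rm)ᵢⱼₖₗ`. -/
def covRiem (g : MetricField n) (p i j k l : Fin (n + 1)) (x : Coord n) : ℝ :=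
  pd p (riem g i j k l) x
    - ∑ m, (christoffel g m p i x * riem g m j k l x
        + christoffel g m p j x * riem g i m k l x
        + christoffel g m p k x * riem g i j m l x
        + christoffel g m p l x * riem g i j k m x)

/-- The components `(∇ₚ Ric)ᵢⱼ`. -/
def covRicci (g : MetricField n) (p i j : Fin (n + 1)) (x : Coord n) : ℝ :=
  pd p (ricci g i j) x
    - ∑ m, (christoffel g m p i x * ricci g m j x + christoffel g m p j x * ricci g i m x)

/-! ### Curvature conditions -/

/-- `Ric = lam g` on `U`. -/
def HasEinsteinConstantOn (g : MetricField n) (lam : ℝ) (U : Set (Coord n)) : Prop :=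
  ∀ x ∈ U, ∀ i j, ricci g i j x = lam * g x i j

/-- `Ric = 0` on `U`. -/
def IsRicciFlatOn (g : MetricField n) (U : Set (Coord n)) : Prop :=
  ∀ x ∈ U, ∀ i j, ricci g i j x = 0

/-- `Rm = 0` on `U`. -/
def IsFlatOn (g : MetricField n) (U : Set (Coord n)) : Prop :=
  ∀ x ∈ U, ∀ i j k l, riem g i j k l x = 0

/-- Every point of `U` has an open neighborhood on which some metric `e^{2f} g`, with `f` smooth,
is flat. -/
def IsLocallyConformallyFlatOn (g : MetricField n) (U : Set (Coord n)) : Prop :=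
  ∀ p ∈ U, ∃ V : Set (Coord n), IsOpen V ∧ p ∈ V ∧ V ⊆ U ∧
    ∃ f : Coord n → ℝ, ContDiffOn ℝ ∞ f V ∧
      IsFlatOn (fun x => Real.exp (2 * f x) • g x) V

/-- `∇ Rm = 0` on `U`. -/
def IsLocallySymmetricOn (g : MetricField n) (U : Set (Coord n)) : Prop :=
  ∀ x ∈ U, ∀ p i j k l, covRiem g p i j k l x = 0

/-- `∇ Ric = 0` on `U`. -/
def HasParallelRicciOn (g : MetricField n) (U : Set (Coord n)) : Prop :=
  ∀ x ∈ U, ∀ p i j, covRicci g p i j x = 0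

/-! ### Null coordinates and the plane wave limit -/

/-- The metric has null coordinate form on `U`: its first row is `(0, 1, 0, …, 0)` (hence, the
metric being symmetric, also its first column); the other components are arbitrary. -/
def IsNullFormOn (g : MetricField n) (U : Set (Coord n)) : Prop :=
  ∀ x ∈ U, ∀ j, g x 0 j = if j = 1 then 1 else 0

/-- The point `(x⁰, 0, …, 0)`. -/
def axisPoint (x : Coord n) : Coord n := Pi.single 0 (x 0)

/-- The plane wave limit `2 dx⁰ dx¹ + ∑_{i,j ≥ 2} g_{ij}(x⁰, 0, …, 0) dxⁱ dxʲ` of `g`. -/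
def planeWave (g : MetricField n) : MetricField n := fun x i j =>
  if (i = 0 ∧ j = 1) ∨ (i = 1 ∧ j = 0) then 1
  else if i = 0 ∨ i = 1 ∨ j = 0 ∨ j = 1 then 0
  else g (axisPoint x) i j

/-- The domain of the plane wave limit of a metric on `U`: the points `x` with
`(x⁰, 0, …, 0) ∈ U`. -/
def planeWaveDomain (U : Set (Coord n)) : Set (Coord n) := {x | axisPoint x ∈ U}

/-- The scaling weights `1, ε², ε, …, ε`. -/
def weight (ε : ℝ) (i : Fin (n + 1)) : ℝ := if i = 0 then 1 else if i = 1 then ε ^ 2 else ε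

/-- The inverse `(x⁰, ε² x¹, ε x², …, ε xⁿ)` of the map
`x ↦ (x⁰, x¹ / ε², x² / ε, …, xⁿ / ε)`. -/
def rescale (ε : ℝ) (x : Coord n) : Coord n := fun i => weight ε i * x i

/-- The components of the pullback `F* g`. -/
def pullback (F : Coord n → Coord n) (g : MetricField n) : MetricField n := fun x i j =>
  ∑ a, ∑ b, pd i (fun y => F y a) x * pd j (fun y => F y b) x * g (F x) a b

theorem pullback_rescale (ε : ℝ) (g : MetricField n) (x : Coord n) (i j : Fin (n + 1)) :
    pullback (rescale ε) g x i j = weight ε i * weight ε j * g (rescale ε x) i j := by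
  have key : ∀ i a : Fin (n + 1),
      pd i (fun y : Coord n => rescale ε y a) x = if a = i then weight ε i else 0 := by
    intro i a
    have h : HasFDerivAt (fun y : Coord n => rescale ε y a)
        (weight ε a • ContinuousLinearMap.proj (R := ℝ) (φ := fun _ : Fin (n + 1) => ℝ) a) x :=
      (ContinuousLinearMap.proj (R := ℝ) (φ := fun _ : Fin (n + 1) => ℝ) a).hasFDerivAt.const_mul
        (weight ε a)
    rw [pd, h.fderiv]
    by_cases hai : a = i
    · subst hai; simp
    · simp [hai]
  simp only [pullback, key, ite_mul, mul_ite, zero_mul, mul_zero, Finset.sum_ite_eq',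
    Finset.mem_univ, if_true]

/-- `planeWave g` is the pointwise limit, as `ε → 0⁺`, of the metrics `ε⁻² (φ_ε⁻¹)* g`, where
`φ_ε(x) = (x⁰, x¹ / ε², x² / ε, …, xⁿ / ε)`. -/
theorem tendsto_planeWave (hn : 1 ≤ n) {g : MetricField n} {U : Set (Coord n)} (hU : IsOpen U)
    (hg : ∀ i j, ContinuousOn (fun x => g x i j) U) (hsymm : ∀ x ∈ U, ∀ i j, g x i j = g x j i)
    (hnull : IsNullFormOn g U) {x : Coord n} (hx : x ∈ planeWaveDomain U) (i j : Fin (n + 1)) :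
    Filter.Tendsto (fun ε : ℝ => pullback (rescale ε) g x i j / ε ^ 2)
      (nhdsWithin 0 (Set.Ioi 0)) (nhds (planeWave g x i j)) := by
  have h10 : (1 : Fin (n + 1)) ≠ 0 := by
    obtain ⟨m, rfl⟩ := Nat.exists_eq_add_of_le' hn
    simp
  have hcont : Continuous fun ε : ℝ => rescale ε x := by
    refine continuous_pi fun a => ?_
    unfold rescale weight
    split_ifs <;> fun_prop
  have hr0 : rescale 0 x = axisPoint x := by
    funext a
    by_cases h0 : a = 0
    · subst h0; simp [rescale, weight, axisPoint]
    · by_cases h1 : a = 1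
      · subst h1; simp [rescale, weight, axisPoint, h0]
      · simp [rescale, weight, axisPoint, h0, h1]
  have hlim : Filter.Tendsto (fun ε : ℝ => rescale ε x) (nhdsWithin 0 (Set.Ioi 0))
      (nhds (axisPoint x)) := by
    have := hcont.tendsto 0
    rw [hr0] at this
    exact this.mono_left nhdsWithin_le_nhds
  have hmem : ∀ᶠ ε in nhdsWithin (0 : ℝ) (Set.Ioi 0), rescale ε x ∈ U :=
    hlim.eventually (hU.mem_nhds hx)
  have hgl : ∀ a b, Filter.Tendsto (fun ε : ℝ => g (rescale ε x) a b)
      (nhdsWithin 0 (Set.Ioi 0)) (nhds (g (axisPoint x) a b)) := fun a b =>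
    ((hg a b).continuousAt (hU.mem_nhds hx)).tendsto.comp hlim
  have hid : Filter.Tendsto (fun ε : ℝ => ε) (nhdsWithin 0 (Set.Ioi 0)) (nhds 0) :=
    Filter.tendsto_id.mono_left nhdsWithin_le_nhds
  have hpos : ∀ᶠ ε in nhdsWithin (0 : ℝ) (Set.Ioi 0), 0 < ε := self_mem_nhdsWithin
  have hrow : ∀ b : Fin (n + 1), ∀ᶠ ε in nhdsWithin (0 : ℝ) (Set.Ioi 0),
      weight ε (0 : Fin (n + 1)) * weight ε b * g (rescale ε x) 0 b / ε ^ 2 = if b = 1 then 1 else 0 := by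
    intro b
    filter_upwards [hmem, hpos] with ε h1 h2
    rw [hnull _ h1]
    by_cases hb : b = 1
    · subst hb; simp [weight, h10, h2.ne']
    · simp [hb]
  simp only [pullback_rescale]
  by_cases hi0 : i = 0
  · subst hi0
    refine (tendsto_const_nhds (x := planeWave g x 0 j)).congr' ?_
    filter_upwards [hrow j] with ε h
    rw [h]
    simp [planeWave, h10.symm]
  by_cases hj0 : j = 0
  · subst hj0
    refine (tendsto_const_nhds (x := planeWave g x i 0)).congr' ?_
    filter_upwards [hrow i, hmem] with ε h h2
    rw [hsymm _ h2, mul_comm (weight ε i), h]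
    simp [planeWave, h10.symm, hi0]
  by_cases hi1 : i = 1
  · subst hi1
    by_cases hj1 : j = 1
    · subst hj1
      have := (hid.pow 2).mul (hgl 1 1)
      simp only [planeWave, h10, and_false, false_and, or_self, or_true, true_or, if_true,
        if_false]
      rw [zero_pow two_ne_zero, zero_mul] at this
      refine this.congr' ?_
      filter_upwards [hpos] with ε h
      simp only [weight, h10, if_true, if_false]
      field_simp
    · have := hid.mul (hgl 1 j)
      simp only [planeWave, h10, hj0, hj1, and_false, false_and, or_self, or_true, true_or,
        if_true, if_false]
      rw [zero_mul] at this
      refine this.congr' ?_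
      filter_upwards [hpos] with ε h
      simp only [weight, h10, hj0, hj1, if_true, if_false]
      field_simp
  · by_cases hj1 : j = 1
    · subst hj1
      have := hid.mul (hgl i 1)
      simp only [planeWave, h10, hi0, hi1, and_false, false_and, or_self, or_true,
        if_true, if_false]
      rw [zero_mul] at this
      refine this.congr' ?_
      filter_upwards [hpos] with ε h
      simp only [weight, h10, hi0, hi1, if_true, if_false]
      field_simp
    · simp only [planeWave, hi0, hj0, hi1, hj1, and_false, or_self, if_false]
      refine (hgl i j).congr' ?_
      filter_upwards [hpos] with ε h
      simp only [weight, hi0, hj0, hi1, hj1, if_false]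
      field_simp

end NullLimit

end

/-! For `ε ≠ 0` the map `φ_ε⁻¹` is a homothety onto `g` from `K_ε = ε⁻² (φ_ε⁻¹)* g`, so `K_ε` is
locally symmetric or Ricci-parallel whenever `g` is, and `Ric = λ g` turns into `Ric = ε² λ K_ε`. In
null coordinates the components of `K_ε` contain no negative power of `ε`: the family extends
smoothly to `ε = 0`, where it equals the plane wave and is still nondegenerate. Its curvature
tensors and their covariant derivatives are therefore jointly continuous in `(ε, x)` up to `ε = 0`,
and the identities pass to the limit. If `e^{2f} g` is flat, the same argument applies to the family
`e^{2 f ∘ φ_ε⁻¹} K_ε`. -/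

noncomputable section

namespace NullLimit

open Matrix Topology

variable {n : ℕ}

section Smoothness

variable {E ι : Type*} [NormedAddCommGroup E] [NormedSpace ℝ E] [Fintype ι] [DecidableEq ι]
  {k : ℕ∞ω} {s : Set E} {M : E → Matrix ι ι ℝ}

theorem contDiffOn_det (hM : ∀ i j, ContDiffOn ℝ k (fun x => M x i j) s) :
    ContDiffOn ℝ k (fun x => (M x).det) s := by
  simp only [det_apply']
  fun_prop

theorem contDiffOn_inv_apply (hM : ∀ i j, ContDiffOn ℝ k (fun x => M x i j) s)
    (hdet : ∀ x ∈ s, (M x).det ≠ 0) (i j : ι) :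
    ContDiffOn ℝ k (fun x => (M x)⁻¹ i j) s := by
  have hadj : ContDiffOn ℝ k (fun x => (M x).adjugate i j) s := by
    simp only [adjugate_apply]
    refine contDiffOn_det fun a b => ?_
    by_cases ha : a = j
    · simpa only [ha, updateRow_self] using contDiffOn_const
    · simpa only [updateRow_ne ha] using hM a b
  simpa [inv_def, Ring.inverse_eq_inv'] using ((contDiffOn_det hM).inv hdet).mul hadj

end Smoothness

section Families

variable {P : Type*} [NormedAddCommGroup P] [NormedSpace ℝ P]

theorem contDiffOn_pd {W : Set (P × Coord n)} (hW : IsOpen W) {F : P → Coord n → ℝ}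
    (hF : ContDiffOn ℝ ∞ (fun q : P × Coord n => F q.1 q.2) W) (i : Fin (n + 1)) :
    ContDiffOn ℝ ∞ (fun q : P × Coord n => pd i (F q.1) q.2) W := by
  have hdF : ContDiffOn ℝ ∞ (fderiv ℝ fun q : P × Coord n => F q.1 q.2) W :=
    hF.fderiv_of_isOpen hW (by simp)
  refine (hdF.clm_apply (contDiffOn_const (c := ((0 : P), Pi.single i (1 : ℝ))))).congr ?_
  rintro ⟨p, x⟩ hq
  have hdiff : DifferentiableAt ℝ (fun q : P × Coord n => F q.1 q.2) (p, x) :=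
    (hF.contDiffAt (hW.mem_nhds hq)).differentiableAt (by simp)
  have hslice : HasFDerivAt (F p) _ x :=
    hdiff.hasFDerivAt.comp x (hasFDerivAt_prodMk_right p x)
  simp [pd, hslice.fderiv]

/-- A family `(K p)` of nondegenerate component matrices over the slices of `W`, jointly smooth in
the parameter and the point.  Neither symmetry nor a signature is imposed. -/
structure IsSmoothMetricFamilyOn (K : P → MetricField n) (W : Set (P × Coord n)) : Prop where
  contDiffOn : ∀ i j, ContDiffOn ℝ ∞ (fun q : P × Coord n => K q.1 q.2 i j) W
  det_ne_zero : ∀ q ∈ W, (K q.1 q.2).det ≠ 0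

namespace IsSmoothMetricFamilyOn

variable {K : P → MetricField n} {W : Set (P × Coord n)}

theorem contDiffOn_christoffel (hK : IsSmoothMetricFamilyOn K W) (hW : IsOpen W)
    (k i j : Fin (n + 1)) :
    ContDiffOn ℝ ∞ (fun q : P × Coord n => christoffel (K q.1) k i j q.2) W := by
  have hinv := contDiffOn_inv_apply hK.contDiffOn hK.det_ne_zero
  have hpd := fun l a b =>
    contDiffOn_pd hW (F := fun p y => K p y a b) (hK.contDiffOn a b) l
  exact contDiffOn_const.mul <| .sum fun l _ =>
    (hinv k l).mul (((hpd i j l).add (hpd j i l)).sub (hpd l i j))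

theorem contDiffOn_curvEndo (hK : IsSmoothMetricFamilyOn K W) (hW : IsOpen W)
    (i j k l : Fin (n + 1)) :
    ContDiffOn ℝ ∞ (fun q : P × Coord n => curvEndo (K q.1) i j k l q.2) W := by
  have hΓ := hK.contDiffOn_christoffel hW
  have hpd := fun p a b c =>
    contDiffOn_pd hW (F := fun q => christoffel (K q) a b c) (hΓ a b c) p
  unfold curvEndo
  fun_prop

theorem contDiffOn_riem (hK : IsSmoothMetricFamilyOn K W) (hW : IsOpen W)
    (i j k l : Fin (n + 1)) :
    ContDiffOn ℝ ∞ (fun q : P × Coord n => riem (K q.1) i j k l q.2) W := by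
  have hR := hK.contDiffOn_curvEndo hW
  have hmetric := hK.contDiffOn
  unfold riem
  fun_prop

theorem contDiffOn_ricci (hK : IsSmoothMetricFamilyOn K W) (hW : IsOpen W)
    (j k : Fin (n + 1)) :
    ContDiffOn ℝ ∞ (fun q : P × Coord n => ricci (K q.1) j k q.2) W :=
  .sum fun i _ => hK.contDiffOn_curvEndo hW i j k i

theorem contDiffOn_covRiem (hK : IsSmoothMetricFamilyOn K W) (hW : IsOpen W)
    (p i j k l : Fin (n + 1)) :
    ContDiffOn ℝ ∞ (fun q : P × Coord n => covRiem (K q.1) p i j k l q.2) W := by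
  have hΓ := hK.contDiffOn_christoffel hW
  have hR := hK.contDiffOn_riem hW
  have hpd := contDiffOn_pd hW (F := fun q => riem (K q) i j k l) (hR i j k l) p
  unfold covRiem
  fun_prop

theorem contDiffOn_covRicci (hK : IsSmoothMetricFamilyOn K W) (hW : IsOpen W)
    (p i j : Fin (n + 1)) :
    ContDiffOn ℝ ∞ (fun q : P × Coord n => covRicci (K q.1) p i j q.2) W := by
  have hΓ := hK.contDiffOn_christoffel hW
  have hR := hK.contDiffOn_ricci hW
  have hpd := contDiffOn_pd hW (F := fun q => ricci (K q) i j) (hR i j) p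
  unfold covRicci
  fun_prop

end IsSmoothMetricFamilyOn

end Families

theorem eqOn_of_forall_fst_ne {P X Y : Type*} [TopologicalSpace P] [TopologicalSpace X]
    [TopologicalSpace Y] [T2Space Y] {p₀ : P} [(𝓝[≠] p₀).NeBot] {W : Set (P × X)} (hW : IsOpen W)
    {F G : P × X → Y} (hF : ContinuousOn F W) (hG : ContinuousOn G W)
    (h : ∀ q ∈ W, q.1 ≠ p₀ → F q = G q) : Set.EqOn F G W := by
  have hdense : Dense (Prod.fst ⁻¹' {p₀}ᶜ : Set (P × X)) :=
    (dense_compl_singleton p₀).preimage isOpenMap_fst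
  have hEq : Set.EqOn F G (W ∩ Prod.fst ⁻¹' {p₀}ᶜ) := fun q hq => h q hq.1 hq.2
  exact hEq.of_subset_closure hF hG Set.inter_subset_left
    (hdense.open_subset_closure_inter hW)

section Dilations

theorem inv_diagonal_of_ne_zero {ι 𝕜 : Type*} [Fintype ι] [DecidableEq ι] [Field 𝕜] {v : ι → 𝕜}
    (hv : ∀ i, v i ≠ 0) : (diagonal v)⁻¹ = diagonal v⁻¹ :=
  inv_eq_left_inv <| by simp [diagonal_mul_diagonal, hv]

/-- Multiplication by nonvanishing weights, coordinate by coordinate, as a linear isomorphism. -/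
def dilationEquiv {w : Fin (n + 1) → ℝ} (hw : ∀ i, w i ≠ 0) : Coord n ≃L[ℝ] Coord n :=
  ContinuousLinearEquiv.piCongrRight fun i =>
    ContinuousLinearEquiv.unitsEquivAut ℝ (Units.mk0 (w i) (hw i))

theorem dilationEquiv_apply {w : Fin (n + 1) → ℝ} (hw : ∀ i, w i ≠ 0) (x : Coord n) :
    dilationEquiv hw x = w * x := by
  ext i
  simp [dilationEquiv, mul_comm]

theorem pd_eq_of_eq_comp_dilation {w : Fin (n + 1) → ℝ} (hw : ∀ i, w i ≠ 0) {V : Set (Coord n)}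
    (hV : IsOpen V) {F f : Coord n → ℝ} {a : ℝ} (h : ∀ x, w * x ∈ V → F x = a * f (w * x))
    (i : Fin (n + 1)) {x : Coord n} (hx : w * x ∈ V) :
    pd i F x = a * w i * pd i f (w * x) := by
  have hnear : F =ᶠ[𝓝 x] a • (f ∘ dilationEquiv hw) := by
    filter_upwards [(hV.preimage (continuous_const_mul w)).mem_nhds hx] with y hy
    simpa [dilationEquiv_apply] using h y hy
  have hbasis : dilationEquiv hw (Pi.single i 1) = w i • (Pi.single i 1 : Coord n) := by
    ext j
    by_cases hj : j = i <;> simp [dilationEquiv_apply, hj]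
  rw [pd, hnear.fderiv_eq, fderiv_const_smul_field, Pi.smul_apply,
    ContinuousLinearEquiv.comp_right_fderiv]
  simp only [_root_.smul_apply, ContinuousLinearMap.comp_apply, ContinuousLinearEquiv.coe_coe,
    hbasis, map_smul, smul_eq_mul, pd, dilationEquiv_apply]
  ring

/-- Over the preimage of `V` under the linear isomorphism `D x = w * x`, the field `K` is the
constant multiple `c • D* G` of the pullback of `G`, so that `D` is a homothety of `K` onto `G`. -/
structure IsDilationOn (w : Fin (n + 1) → ℝ) (c : ℝ) (K G : MetricField n)
    (V : Set (Coord n)) : Prop where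
  weight_ne_zero : ∀ i, w i ≠ 0
  factor_ne_zero : c ≠ 0
  apply_eq : ∀ x, w * x ∈ V → ∀ i j, K x i j = c * w i * w j * G (w * x) i j

namespace IsDilationOn

variable {w : Fin (n + 1) → ℝ} {c : ℝ} {K G : MetricField n} {V : Set (Coord n)}

theorem inv_apply (h : IsDilationOn w c K G V) {x : Coord n} (hx : w * x ∈ V)
    (i j : Fin (n + 1)) : (K x)⁻¹ i j = (c * w i * w j)⁻¹ * (G (w * x))⁻¹ i j := by
  have hcw : ∀ i, c * w i ≠ 0 := fun i => mul_ne_zero h.factor_ne_zero (h.weight_ne_zero i)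
  have hfactor : K x = diagonal (fun i => c * w i) * G (w * x) * diagonal w := by
    ext i j
    rw [mul_diagonal, diagonal_mul, h.apply_eq x hx]
    ring
  rw [hfactor, Matrix.mul_inv_rev, Matrix.mul_inv_rev, inv_diagonal_of_ne_zero h.weight_ne_zero,
    inv_diagonal_of_ne_zero hcw, ← mul_assoc, mul_diagonal, diagonal_mul]
  simp only [Pi.inv_apply]
  ring

theorem christoffel_eq (h : IsDilationOn w c K G V) (hV : IsOpen V) (k i j : Fin (n + 1))
    {x : Coord n} (hx : w * x ∈ V) :
    christoffel K k i j x = w i * w j * (w k)⁻¹ * christoffel G k i j (w * x) := by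
  have hpd : ∀ p a b, pd p (fun y => K y a b) x =
      c * w a * w b * w p * pd p (fun y => G y a b) (w * x) := fun p a b =>
    pd_eq_of_eq_comp_dilation h.weight_ne_zero hV (fun y hy => h.apply_eq y hy a b) p hx
  simp only [christoffel, hpd, h.inv_apply hx, Finset.mul_sum]
  refine Finset.sum_congr rfl fun l _ => ?_
  have hc := h.factor_ne_zero
  have hw := h.weight_ne_zero l
  field_simp

theorem curvEndo_eq (h : IsDilationOn w c K G V) (hV : IsOpen V) (i j k l : Fin (n + 1))
    {x : Coord n} (hx : w * x ∈ V) :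
    curvEndo K i j k l x = w i * w j * w k * (w l)⁻¹ * curvEndo G i j k l (w * x) := by
  have hpd : ∀ p a b d, pd p (christoffel K a b d) x =
      w b * w d * (w a)⁻¹ * w p * pd p (christoffel G a b d) (w * x) := fun p a b d =>
    pd_eq_of_eq_comp_dilation h.weight_ne_zero hV (fun _ => h.christoffel_eq hV a b d) p hx
  simp only [curvEndo, hpd, h.christoffel_eq hV _ _ _ hx, mul_add, Finset.mul_sum]
  congr 1
  · ring
  · refine Finset.sum_congr rfl fun m _ => ?_
    have hw := h.weight_ne_zero m
    field_simp

theorem riem_eq (h : IsDilationOn w c K G V) (hV : IsOpen V) (i j k l : Fin (n + 1))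
    {x : Coord n} (hx : w * x ∈ V) :
    riem K i j k l x = c * w i * w j * w k * w l * riem G i j k l (w * x) := by
  simp only [riem, h.curvEndo_eq hV _ _ _ _ hx, h.apply_eq x hx, Finset.mul_sum]
  refine Finset.sum_congr rfl fun m _ => ?_
  have hw := h.weight_ne_zero m
  field_simp

theorem ricci_eq (h : IsDilationOn w c K G V) (hV : IsOpen V) (j k : Fin (n + 1))
    {x : Coord n} (hx : w * x ∈ V) :
    ricci K j k x = w j * w k * ricci G j k (w * x) := by
  simp only [ricci, h.curvEndo_eq hV _ _ _ _ hx, Finset.mul_sum]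
  refine Finset.sum_congr rfl fun m _ => ?_
  have hw := h.weight_ne_zero m
  field_simp

theorem covRiem_eq (h : IsDilationOn w c K G V) (hV : IsOpen V) (p i j k l : Fin (n + 1))
    {x : Coord n} (hx : w * x ∈ V) :
    covRiem K p i j k l x =
      c * w p * w i * w j * w k * w l * covRiem G p i j k l (w * x) := by
  have hpd := pd_eq_of_eq_comp_dilation h.weight_ne_zero hV
    (fun _ => h.riem_eq hV i j k l) p hx
  simp only [covRiem, hpd, h.riem_eq hV _ _ _ _ hx, h.christoffel_eq hV _ _ _ hx, mul_sub,
    Finset.mul_sum]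
  congr 1
  · ring
  · refine Finset.sum_congr rfl fun m _ => ?_
    have hw := h.weight_ne_zero m
    field_simp

theorem covRicci_eq (h : IsDilationOn w c K G V) (hV : IsOpen V) (p i j : Fin (n + 1))
    {x : Coord n} (hx : w * x ∈ V) :
    covRicci K p i j x = w p * w i * w j * covRicci G p i j (w * x) := by
  have hpd := pd_eq_of_eq_comp_dilation h.weight_ne_zero hV (fun _ => h.ricci_eq hV i j) p hx
  simp only [covRicci, hpd, h.ricci_eq hV _ _ hx, h.christoffel_eq hV _ _ _ hx, mul_sub,
    Finset.mul_sum]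
  congr 1
  · ring
  · refine Finset.sum_congr rfl fun m _ => ?_
    have hw := h.weight_ne_zero m
    field_simp

end IsDilationOn

end Dilations

theorem zero_ne_one_of_one_le (hn : 1 ≤ n) : (0 : Fin (n + 1)) ≠ 1 := by
  simpa [eq_comm, Fin.one_eq_zero_iff] using Nat.one_le_iff_ne_zero.1 hn

namespace IsLorentzianMatrix

variable {A B : Matrix (Fin (n + 1)) (Fin (n + 1)) ℝ}

theorem det_ne_zero (hA : IsLorentzianMatrix A) : A.det ≠ 0 := by
  obtain ⟨P, -, hP⟩ := hA
  have hM : (minkowski n).det ≠ 0 := by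
    rw [minkowski, det_diagonal, Finset.prod_ne_zero_iff]
    intro i _
    split_ifs <;> norm_num
  rw [← hP, det_mul, det_mul] at hM
  exact right_ne_zero_of_mul (left_ne_zero_of_mul hM)

theorem isSymm (hA : IsLorentzianMatrix A) : A.IsSymm := by
  obtain ⟨P, hdet, hP⟩ := hA
  have hunit : IsUnit P := (isUnit_iff_isUnit_det P).2 hdet
  have hcongr : Pᵀ * Aᵀ * P = Pᵀ * A * P := by
    calc Pᵀ * Aᵀ * P = (Pᵀ * A * P)ᵀ := by simp only [transpose_mul, transpose_transpose, mul_assoc]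
      _ = Pᵀ * A * P := by rw [hP, minkowski, diagonal_transpose]
  exact ((isUnit_transpose P).2 hunit).mul_left_cancel (hunit.mul_right_cancel hcongr)

theorem transpose_mul_mul (hA : IsLorentzianMatrix A)
    {Q : Matrix (Fin (n + 1)) (Fin (n + 1)) ℝ} (hQ : IsUnit Q.det) :
    IsLorentzianMatrix (Qᵀ * A * Q) := by
  obtain ⟨P, hdet, hP⟩ := hA
  refine ⟨Q⁻¹ * P, ?_, ?_⟩
  · rw [det_mul]
    exact (isUnit_nonsing_inv_det Q hQ).mul hdet
  · have hQP : Q * (Q⁻¹ * P) = P := mul_nonsing_inv_cancel_left Q P hQ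
    calc (Q⁻¹ * P)ᵀ * (Qᵀ * A * Q) * (Q⁻¹ * P)
        = (Q * (Q⁻¹ * P))ᵀ * A * (Q * (Q⁻¹ * P)) := by
          simp only [transpose_mul, mul_assoc]
      _ = minkowski n := by rw [hQP, hP]

/-- The shear `x ↦ x + (v ⬝ x) u` along a null vector `u` transforms `A` into this matrix. -/
theorem add_vecMulVec_add_vecMulVec (hA : IsLorentzianMatrix A) {u v : Fin (n + 1) → ℝ}
    (hu : u ⬝ᵥ A *ᵥ u = 0) (hvu : v ⬝ᵥ u = 0) :
    IsLorentzianMatrix (A + vecMulVec (A *ᵥ u) v + vecMulVec v (A *ᵥ u)) := by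
  have hunit : IsUnit (1 + vecMulVec u v).det := by
    rw [vecMulVec_eq Unit, det_one_add_replicateCol_mul_replicateRow, hvu, add_zero]
    exact isUnit_one
  have hrow : u ᵥ* A = A *ᵥ u := by rw [← mulVec_transpose, hA.isSymm.eq]
  convert hA.transpose_mul_mul hunit using 1
  simp only [transpose_add, transpose_one, transpose_vecMulVec, add_mul, mul_add, one_mul, mul_one,
    vecMulVec_mul, mul_vecMulVec, vecMulVec_mulVec, hrow]
  simp only [dotProduct_comm _ u, hu, MulOpposite.op_zero, zero_smul,
    zero_vecMulVec]
  abel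

/-- The basis vector `e₀` is null and `A e₀ = e₁`, so a shear along `e₀` changes row and column `1`
of `A` at will, except for the entry `0, 1`. -/
theorem of_nullForm (hn : 1 ≤ n) (hA : IsLorentzianMatrix A)
    (hA0 : ∀ j, A 0 j = if j = 1 then 1 else 0) (hB : B.IsSymm) (hB01 : B 0 1 = 1)
    (hAB : ∀ i j, i ≠ 1 → j ≠ 1 → B i j = A i j) : IsLorentzianMatrix B := by
  have h01 := zero_ne_one_of_one_le hn
  let v : Fin (n + 1) → ℝ := fun j => if j = 1 then (B 1 1 - A 1 1) / 2 else B 1 j - A 1 j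
  have hcol : A *ᵥ Pi.single 0 1 = Pi.single 1 1 := by
    ext i
    rw [mulVec_single_one, col_apply, hA.isSymm.apply, hA0, Pi.single_apply]
  have hv0 : v 0 = 0 := by
    simp [v, h01, hB.apply 0 1, hA.isSymm.apply 0 1, hB01, hA0]
  have hB_eq : B = A + vecMulVec (Pi.single 1 1) v + vecMulVec v (Pi.single 1 1) := by
    ext i j
    have hBi := hB.apply i 1
    have hAi := hA.isSymm.apply i 1
    simp only [Matrix.add_apply, vecMulVec_apply, Pi.single_apply, v]
    grind
  rw [hB_eq, ← hcol]
  exact hA.add_vecMulVec_add_vecMulVec (by simp [hcol, h01]) (by simp [hv0])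

end IsLorentzianMatrix

section PenroseLimit

/-- The parameters `ε` and points of coordinate space which the dilation `rescale ε` maps
into `U`. -/
def rescaleDomain (U : Set (Coord n)) : Set (ℝ × Coord n) := {q | rescale q.1 q.2 ∈ U}

theorem weight_ne_zero {ε : ℝ} (hε : ε ≠ 0) (i : Fin (n + 1)) : weight ε i ≠ 0 := by
  unfold weight
  split_ifs <;> simp [hε]

theorem rescale_eq_mul (ε : ℝ) (x : Coord n) : rescale ε x = weight ε * x := rfl

theorem contDiff_rescale : ContDiff ℝ ∞ fun q : ℝ × Coord n => rescale q.1 q.2 := by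
  refine contDiff_pi.2 fun i => ?_
  unfold rescale weight
  split_ifs <;> fun_prop

theorem rescale_zero (x : Coord n) : rescale 0 x = axisPoint x := by
  ext i
  by_cases hi : i = 0 <;> simp [rescale, weight, axisPoint, hi]

theorem contDiff_axisPoint : ContDiff ℝ ∞ (axisPoint : Coord n → Coord n) :=
  (ContinuousLinearMap.single ℝ (fun _ : Fin (n + 1) => ℝ) 0).contDiff.comp
    (contDiff_apply ℝ ℝ 0)

variable {U V : Set (Coord n)}

theorem isOpen_rescaleDomain (hU : IsOpen U) : IsOpen (rescaleDomain U) :=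
  hU.preimage contDiff_rescale.continuous

theorem mk_zero_mem_rescaleDomain {x : Coord n} :
    ((0 : ℝ), x) ∈ rescaleDomain U ↔ x ∈ planeWaveDomain U := by
  rw [rescaleDomain, Set.mem_ofPred_eq, rescale_zero]
  rfl

theorem eq_zero_of_forall_rescale_mem (hV : IsOpen V) {F : ℝ × Coord n → ℝ}
    (hF : ContinuousOn F (rescaleDomain V))
    (h : ∀ ε x, ε ≠ 0 → rescale ε x ∈ V → F (ε, x) = 0) {x : Coord n}
    (hx : x ∈ planeWaveDomain V) : F (0, x) = 0 :=
  eqOn_of_forall_fst_ne (isOpen_rescaleDomain hV) hF continuousOn_const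
    (fun q hq hne => h q.1 q.2 hne hq) (mk_zero_mem_rescaleDomain.2 hx)

/-- A smooth family of metrics extending the rescalings `ε⁻² (φ_ε⁻¹)* G`, `ε ≠ 0`, of `G`
to `ε = 0`: its member `K 0` is the Penrose limit of `G`. -/
structure IsPenroseFamilyOn (K : ℝ → MetricField n) (G : MetricField n) (V : Set (Coord n)) : Prop
    extends IsSmoothMetricFamilyOn K (rescaleDomain V) where
  eq_pullback : ∀ ε x, ε ≠ 0 → rescale ε x ∈ V →
    K ε x = (ε ^ 2)⁻¹ • pullback (rescale ε) G x

namespace IsPenroseFamilyOn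

variable {K : ℝ → MetricField n} {G : MetricField n}

theorem mono (hK : IsPenroseFamilyOn K G U) (hVU : V ⊆ U) : IsPenroseFamilyOn K G V where
  contDiffOn i j := (hK.contDiffOn i j).mono fun _ hq => hVU hq
  det_ne_zero q hq := hK.det_ne_zero q (hVU hq)
  eq_pullback ε x hε hx := hK.eq_pullback ε x hε (hVU hx)

theorem conformal (hK : IsPenroseFamilyOn K G V) {f : Coord n → ℝ} (hf : ContDiffOn ℝ ∞ f V) :
    IsPenroseFamilyOn (fun ε x => Real.exp (2 * f (rescale ε x)) • K ε x)
      (fun x => Real.exp (2 * f x) • G x) V where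
  contDiffOn i j := by
    have hfr : ContDiffOn ℝ ∞ (fun q : ℝ × Coord n => f (rescale q.1 q.2)) (rescaleDomain V) :=
      hf.comp contDiff_rescale.contDiffOn fun _ hq => hq
    exact (contDiffOn_const.mul hfr).exp.mul (hK.contDiffOn i j)
  det_ne_zero q hq := by
    rw [det_smul]
    exact mul_ne_zero (pow_ne_zero _ (Real.exp_ne_zero _)) (hK.det_ne_zero q hq)
  eq_pullback ε x hε hx := by
    ext i j
    simp only [hK.eq_pullback ε x hε hx, Matrix.smul_apply, pullback_rescale, smul_eq_mul]
    ring

theorem isDilationOn (hK : IsPenroseFamilyOn K G V) {ε : ℝ} (hε : ε ≠ 0) :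
    IsDilationOn (weight ε) (ε ^ 2)⁻¹ (K ε) G V where
  weight_ne_zero := weight_ne_zero hε
  factor_ne_zero := inv_ne_zero (pow_ne_zero 2 hε)
  apply_eq x hx i j := by
    rw [hK.eq_pullback ε x hε hx, Matrix.smul_apply, pullback_rescale, smul_eq_mul, rescale_eq_mul]
    ring

theorem isRicciFlatOn_zero (hK : IsPenroseFamilyOn K G V) (hV : IsOpen V) {lam : ℝ}
    (hG : HasEinsteinConstantOn G lam V) : IsRicciFlatOn (K 0) (planeWaveDomain V) := by
  intro x hx i j
  have hRic : ∀ q ∈ rescaleDomain V, q.1 ≠ 0 →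
      ricci (K q.1) i j q.2 = lam * q.1 ^ 2 * K q.1 q.2 i j := by
    intro q hq hne
    have hD := hK.isDilationOn hne
    rw [hD.ricci_eq hV i j hq, hG (weight q.1 * q.2) hq, hD.apply_eq q.2 hq]
    field_simp
  have hlim := eqOn_of_forall_fst_ne (isOpen_rescaleDomain hV)
    (hK.contDiffOn_ricci (isOpen_rescaleDomain hV) i j).continuousOn
    (((continuous_const.mul (continuous_fst.pow 2)).continuousOn).mul
      (hK.contDiffOn i j).continuousOn) hRic (mk_zero_mem_rescaleDomain.2 hx)
  simpa using hlim

theorem isFlatOn_zero (hK : IsPenroseFamilyOn K G V) (hV : IsOpen V) (hG : IsFlatOn G V) :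
    IsFlatOn (K 0) (planeWaveDomain V) := by
  intro x hx i j k l
  refine eq_zero_of_forall_rescale_mem hV
    (hK.contDiffOn_riem (isOpen_rescaleDomain hV) i j k l).continuousOn (fun ε y hε hy => ?_) hx
  exact ((hK.isDilationOn hε).riem_eq hV i j k l hy).trans (mul_eq_zero_of_right _ (hG _ hy ..))

theorem isLocallySymmetricOn_zero (hK : IsPenroseFamilyOn K G V) (hV : IsOpen V)
    (hG : IsLocallySymmetricOn G V) : IsLocallySymmetricOn (K 0) (planeWaveDomain V) := by
  intro x hx p i j k l
  refine eq_zero_of_forall_rescale_mem hV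
    (hK.contDiffOn_covRiem (isOpen_rescaleDomain hV) p i j k l).continuousOn
    (fun ε y hε hy => ?_) hx
  exact ((hK.isDilationOn hε).covRiem_eq hV p i j k l hy).trans
    (mul_eq_zero_of_right _ (hG _ hy ..))

theorem hasParallelRicciOn_zero (hK : IsPenroseFamilyOn K G V) (hV : IsOpen V)
    (hG : HasParallelRicciOn G V) : HasParallelRicciOn (K 0) (planeWaveDomain V) := by
  intro x hx p i j
  refine eq_zero_of_forall_rescale_mem hV
    (hK.contDiffOn_covRicci (isOpen_rescaleDomain hV) p i j).continuousOn (fun ε y hε hy => ?_) hx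
  exact ((hK.isDilationOn hε).covRicci_eq hV p i j hy).trans
    (mul_eq_zero_of_right _ (hG _ hy ..))

theorem isLocallyConformallyFlatOn_zero (hK : IsPenroseFamilyOn K G U)
    (hG : IsLocallyConformallyFlatOn G U) :
    IsLocallyConformallyFlatOn (K 0) (planeWaveDomain U) := by
  intro p hp
  obtain ⟨V, hV, hpV, hVU, f, hf, hflat⟩ := hG (axisPoint p) hp
  refine ⟨planeWaveDomain V, hV.preimage contDiff_axisPoint.continuous, hpV, fun x hx => hVU hx,
    f ∘ axisPoint, hf.comp contDiff_axisPoint.contDiffOn fun x hx => hx, ?_⟩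
  simpa only [rescale_zero, Function.comp_apply] using
    ((hK.mono hVU).conformal hf).isFlatOn_zero hV hflat

end IsPenroseFamilyOn

/-- The rescalings `ε⁻² (φ_ε⁻¹)* g` of a metric in null form, extended to `ε = 0`.  Row and column
`0` are those of `g`; elsewhere dividing `weight ε i * weight ε j` by `ε ^ 2` leaves one factor `ε`
for each index equal to `1`. -/
def planeWaveFamily (g : MetricField n) (ε : ℝ) : MetricField n := fun x i j =>
  if (i = 0 ∧ j = 1) ∨ (i = 1 ∧ j = 0) then 1
  else if i = 0 ∨ j = 0 then 0
  else (if i = 1 then ε else 1) * (if j = 1 then ε else 1) * g (rescale ε x) i j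

variable {g : MetricField n}

theorem planeWaveFamily_zero (g : MetricField n) : planeWaveFamily g 0 = planeWave g := by
  ext x i j
  unfold planeWaveFamily planeWave
  rw [rescale_zero]
  grind

theorem isLorentzianMatrix_planeWaveFamily (hn : 1 ≤ n) (hg : IsLorentzianMetricOn g U)
    (hnull : IsNullFormOn g U) {ε : ℝ} {x : Coord n} (hx : rescale ε x ∈ U) :
    IsLorentzianMatrix (planeWaveFamily g ε x) := by
  have hA := hg.lorentzian _ hx
  refine hA.of_nullForm hn (hnull _ hx) ?_ (by simp [planeWaveFamily]) fun i j hi hj => ?_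
  · ext i j
    have hsymm := hA.isSymm.apply i j
    simp only [transpose_apply, planeWaveFamily]
    grind
  · have hcol := hA.isSymm.apply i 0
    have hrow := hnull _ hx
    simp only [planeWaveFamily]
    grind

theorem contDiffOn_planeWaveFamily_apply (hg : ∀ i j, ContDiffOn ℝ ∞ (fun x => g x i j) U)
    (i j : Fin (n + 1)) :
    ContDiffOn ℝ ∞ (fun q : ℝ × Coord n => planeWaveFamily g q.1 q.2 i j) (rescaleDomain U) := by
  have hgr : ContDiffOn ℝ ∞ (fun q : ℝ × Coord n => g (rescale q.1 q.2) i j) (rescaleDomain U) :=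
    (hg i j).comp contDiff_rescale.contDiffOn fun _ hq => hq
  unfold planeWaveFamily
  split_ifs <;> first | exact contDiffOn_const | exact ContDiffOn.mul (by fun_prop) hgr

theorem isPenroseFamilyOn_planeWaveFamily (hn : 1 ≤ n) (hg : IsLorentzianMetricOn g U)
    (hnull : IsNullFormOn g U) : IsPenroseFamilyOn (planeWaveFamily g) g U where
  contDiffOn := contDiffOn_planeWaveFamily_apply hg.smooth
  det_ne_zero _ hq := (isLorentzianMatrix_planeWaveFamily hn hg hnull hq).det_ne_zero
  eq_pullback ε x hε hx := by
    ext i j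
    have h01 := zero_ne_one_of_one_le hn
    have hrow := hnull _ hx
    have hcol := (hg.lorentzian _ hx).isSymm.apply i 0
    rw [Matrix.smul_apply, pullback_rescale, smul_eq_mul, eq_inv_mul_iff_mul_eq₀ (pow_ne_zero 2 hε)]
    simp only [planeWaveFamily, weight]
    grind

theorem isLorentzianMetricOn_planeWaveFamily_zero (hn : 1 ≤ n) (hg : IsLorentzianMetricOn g U)
    (hnull : IsNullFormOn g U) :
    IsLorentzianMetricOn (planeWaveFamily g 0) (planeWaveDomain U) := by
  refine ⟨fun i j => ?_, fun x hx => ?_⟩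
  · exact (contDiffOn_planeWaveFamily_apply hg.smooth i j).comp
      (contDiff_prodMk_right 0).contDiffOn fun x hx => mk_zero_mem_rescaleDomain.2 hx
  · exact isLorentzianMatrix_planeWaveFamily hn hg hnull (mk_zero_mem_rescaleDomain.2 hx)

end PenroseLimit

end NullLimit

end

theorem mainTheorem6 (n : ℕ) (hn : 1 ≤ n) (U : Set (NullLimit.Coord n)) (hU : IsOpen U)
    (g : NullLimit.MetricField n) (hg : NullLimit.IsLorentzianMetricOn g U)
    (hnull : NullLimit.IsNullFormOn g U) :
    NullLimit.IsLorentzianMetricOn (NullLimit.planeWave g) (NullLimit.planeWaveDomain U) ∧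
    (∀ lam : ℝ, NullLimit.HasEinsteinConstantOn g lam U →
      NullLimit.IsRicciFlatOn (NullLimit.planeWave g) (NullLimit.planeWaveDomain U)) ∧
    (NullLimit.IsLocallyConformallyFlatOn g U →
      NullLimit.IsLocallyConformallyFlatOn (NullLimit.planeWave g)
        (NullLimit.planeWaveDomain U)) ∧
    (NullLimit.IsLocallySymmetricOn g U →
      NullLimit.IsLocallySymmetricOn (NullLimit.planeWave g) (NullLimit.planeWaveDomain U)) ∧
    (NullLimit.HasParallelRicciOn g U →
      NullLimit.HasParallelRicciOn (NullLimit.planeWave g) (NullLimit.planeWaveDomain U)) := by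
  have hK := NullLimit.isPenroseFamilyOn_planeWaveFamily hn hg hnull
  rw [← NullLimit.planeWaveFamily_zero g]
  exact ⟨NullLimit.isLorentzianMetricOn_planeWaveFamily_zero hn hg hnull,
    fun _ => hK.isRicciFlatOn_zero hU, hK.isLocallyConformallyFlatOn_zero,
    hK.isLocallySymmetricOn_zero hU, hK.hasParallelRicciOn_zero hU⟩
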